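/- Let $A$ and $B$ be bounded operators on a complex Hilbert space $H$, with $A$ normal and $\|B\|=1$. For bounded operators $T_1,\dots,T_k$ on $H$ the proper projective joint spectrum is $$\sigma_p(T_1,\dots,T_k)=\{x\in\mathbb C^k:\ x_1T_1+\cdots+x_kT_k-I\ \text{is not invertible}\}.$$ A point $x\in\sigma_p(T_1,\dots,T_k)$ is said to have multiplicity $m$ if $1$ is an isolated point of the spectrum of $T(x)=x_1T_1+\cdots+x_kT_k$ and the Riesz projection $\frac1{2\pi i}\oint_{|w-1|=\rho}(w-T(x))^{-1}\,dw$ has rank $m$, where $\rho>0$ is so small that $1$ is the only point of the spectrum of $T(x)$ in $\{|w-1|\le\rho\}$. Let $\Delta_3(\tau,\epsilon)=\{w\in\mathbb C^3:\ |w_i-\tau_i|<\epsilon,\ i=1,2,3\}$. Let $n\ge 1$ be an integer and put $\tau_{1j}=(e^{2\pi ij/n},0,0)$, $\tau_{2j}=(0,e^{2\pi ij/n},0)$ for $j=0,\dots,n-1$. Suppose that there is an $\epsilon>0$ such that for $m=1,2$ and $j=0,\dots,n-1$: a) $\sigma_p(A,B,AB)\cap\Delta_3(\tau_{mj},\epsilon)=\{(x,y,z)\in\mathbb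 C^3:\ x^n+y^n+(-1)^{n-1}z^n=1\}\cap\Delta_3(\tau_{mj},\epsilon)$; b) every point of $\sigma_p(A,B,AB)\cap\Delta_3(\tau_{mj},\epsilon)$ has multiplicity one. Then the linear span $L$ of the eigenvectors of $A$ with eigenvalues $e^{2\pi im/n}$, $m=0,\dots,n-1$, has dimension $n$, and 1) $L$ is invariant under $B$; 2) the restriction of $B$ to $L$ is a unitary operator of $L$, and so is the restriction of $A$ to $L$. -/

import Mathlib

noncomputable section

/-- The linear pencil `x₁ T₁ + ... + xₖ Tₖ` of a tuple of bounded operators. -/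
def pencil {H : Type*} [NormedAddCommGroup H] [InnerProductSpace ℂ H] {k : ℕ}
    (T : Fin k → H →L[ℂ] H) (x : Fin k → ℂ) : H →L[ℂ] H :=
  ∑ i, x i • T i

/-- The proper projective joint spectrum `σ_p(T₁, ..., Tₖ) ⊆ ℂᵏ`: the points `x` for which
`x₁ T₁ + ... + xₖ Tₖ - I` is not invertible. -/
def properJointSpectrum {H : Type*} [NormedAddCommGroup H] [InnerProductSpace ℂ H] {k : ℕ}
    (T : Fin k → H →L[ℂ] H) : Set (Fin k → ℂ) :=
  {x | ¬ IsUnit (pencil T x - 1)}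

/-- The open polydisk of radius `r` centered at `c` in `ℂᵏ`. -/
def polydisk {k : ℕ} (c : Fin k → ℂ) (r : ℝ) : Set (Fin k → ℂ) :=
  {w | ∀ j, ‖w j - c j‖ < r}

/-- The Riesz integral `(2πi)⁻¹ ∮_{|w - c| = r} (w - S)⁻¹ dw`. -/
def rieszProjection {H : Type*} [NormedAddCommGroup H] [InnerProductSpace ℂ H]
    (S : H →L[ℂ] H) (c : ℂ) (r : ℝ) : H →L[ℂ] H :=
  (2 * (Real.pi : ℂ) * Complex.I)⁻¹ • ∮ w in C(c, r), resolvent S w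

/-- `c` is an isolated point of the spectrum of `S`, of algebraic multiplicity `m`: the Riesz
projection of `S` over a circle that separates `c` from the rest of the spectrum has rank `m`
(it does not depend on the choice of such a circle). -/
def IsIsolatedSpectralPointOfMultiplicity {H : Type*} [NormedAddCommGroup H]
    [InnerProductSpace ℂ H] (S : H →L[ℂ] H) (c : ℂ) (m : ℕ) : Prop :=
  ∃ r : ℝ, 0 < r ∧ spectrum ℂ S ∩ Metric.closedBall c r = {c} ∧
    LinearMap.rank (rieszProjection S c r : H →ₗ[ℂ] H) = (m : Cardinal)

/-- The point `x` of the proper joint spectrum of `T₁, ..., Tₖ` has multiplicity `m`: one is an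
isolated spectral point, of multiplicity `m`, of the pencil `x₁ T₁ + ... + xₖ Tₖ`. -/
def HasMultiplicityAt {H : Type*} [NormedAddCommGroup H] [InnerProductSpace ℂ H] {k : ℕ}
    (T : Fin k → H →L[ℂ] H) (x : Fin k → ℂ) (m : ℕ) : Prop :=
  IsIsolatedSpectralPointOfMultiplicity (pencil T x) 1 m

/-- The Fourier surface `xⁿ + yⁿ + (-1)ⁿ⁻¹ zⁿ = 1` in `ℂ³` (used for `n ≥ 1`). -/
def fourierSurface (n : ℕ) : Set (Fin 3 → ℂ) :=
  {x | x 0 ^ n + x 1 ^ n + (-1) ^ (n - 1) * x 2 ^ n = 1}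

/-- The `n`-th root of unity `e^{2πij/n}`. -/
def unityRoot (n j : ℕ) : ℂ :=
  Complex.exp (2 * Real.pi * Complex.I * j / n)

/-- The linear span of the eigenvectors of `A` with eigenvalues `e^{2πim/n}`, `0 ≤ m < n`. -/
def rootEigenspan {H : Type*} [NormedAddCommGroup H] [InnerProductSpace ℂ H]
    (A : H →L[ℂ] H) (n : ℕ) : Submodule ℂ H :=
  Submodule.span ℂ
    {v | ∃ m < n, Module.End.HasEigenvector (A : Module.End ℂ H) (unityRoot n m) v}

/-- `L` is invariant under `S` and the restriction of `S` to `L` is a unitary operator of `L`. -/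
def RestrictsToUnitary {H : Type*} [NormedAddCommGroup H] [InnerProductSpace ℂ H]
    (S : H →L[ℂ] H) (L : Submodule ℂ H) : Prop :=
  ∃ U : L ≃ₗᵢ[ℂ] L, ∀ v : L, (U v : H) = S v

end

/-!
Let `cⁿ = 1`. Along the line `(c, u, -cu)`, which lies on the Fourier surface, the pencil factors as
`cA + uB - cu AB - 1 = (cA - 1)(1 - uB)`. At `u = 0`, multiplicity one and normality of `A` make
`ker (cA - 1)` a line `ℂ e` on whose orthogonal complement `cA - 1` is invertible. Move off the
line, staying on the surface, to `(x(t), u + t, -cu)` with `x(0) = c` and `x'(0) = -uⁿ⁻¹ c`, and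
divide by `1 - uB` on the right: the operator stays singular, so the compression of its derivative
at `t = 0` to `ℂ e` vanishes, that is, `⟨e, B(1 - uB)⁻¹ e⟩ = uⁿ⁻¹ ⟨e, (1 - uB)⁻¹ e⟩`. Comparing the
coefficients of `uⁿ⁻¹` gives `⟨e, Bⁿ e⟩ = 1`, and `‖B‖ ≤ 1` then forces `Bⁿ e = e`.

Hence the `n`-dimensional space `ker (Aⁿ - 1)` is contained in `ker (Bⁿ - 1)`, whose dimension is at
most `n` by multiplicity one at the points `(0, c, 0)`. The two spaces coincide, and a contraction
with unimodular eigenvalues is isometric on the span of its eigenvectors.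
-/

open Filter Topology Polynomial Metric
open Module (finrank)

/-! ### Roots of unity and eigenspaces -/

theorem exists_lt_unityRoot_eq_iff {n : ℕ} (hn : 0 < n) {μ : ℂ} :
    (∃ m < n, unityRoot n m = μ) ↔ μ ^ n = 1 := by
  have hω := Complex.isPrimitiveRoot_exp n hn.ne'
  have hpow (m : ℕ) : unityRoot n m = Complex.exp (2 * Real.pi * Complex.I / n) ^ m := by
    rw [unityRoot, ← Complex.exp_nat_mul]
    ring_nf
  simp only [hpow]
  constructor
  · rintro ⟨m, -, rfl⟩
    rw [pow_right_comm, hω.pow_eq_one, one_pow]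
  · have : NeZero n := ⟨hn.ne'⟩
    exact hω.eq_pow_of_pow_eq_one

theorem finrank_iSup_of_iSupIndep {K V ι : Type*} [Field K] [AddCommGroup V] [Module K V]
    [Fintype ι] {p : ι → Submodule K V} [∀ i, FiniteDimensional K (p i)] (hp : iSupIndep p) :
    finrank K ↥(⨆ i, p i) = ∑ i, finrank K (p i) := by
  classical
  rw [Submodule.iSup_eq_range_dfinsupp_lsum,
    LinearMap.finrank_range_of_inj hp.dfinsupp_lsum_injective]
  exact Module.finrank_directSum K fun i => p i

theorem ker_aeval_prod_X_sub_C {K V : Type*} [Field K] [AddCommGroup V] [Module K V]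
    (f : Module.End K V) (s : Finset K) :
    (aeval f (∏ μ ∈ s, (X - C μ))).ker = ⨆ μ ∈ s, f.eigenspace μ := by
  classical
  induction s using Finset.induction_on with
  | empty => simp [Module.End.one_eq_id, LinearMap.ker_id]
  | insert μ s hμ ih =>
    have hcop : IsCoprime (X - C μ) (∏ ν ∈ s, (X - C ν)) :=
      IsCoprime.prod_right fun ν hν => isCoprime_X_sub_C_of_isUnit_sub
        (sub_ne_zero_of_ne (ne_of_mem_of_not_mem hν hμ).symm).isUnit
    rw [Finset.prod_insert hμ, ← sup_ker_aeval_eq_ker_aeval_mul_of_coprime _ hcop, ih,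
      Finset.iSup_insert]
    simp [Module.End.eigenspace_def, Algebra.algebraMap_eq_smul_one]

theorem eigenspace_smul_mul {K V : Type*} [Field K] [AddCommGroup V] [Module K V]
    (f : Module.End K V) {a : K} (ha : a ≠ 0) (μ : K) :
    (a • f).eigenspace (a * μ) = f.eigenspace μ := by
  ext v
  simp [mul_smul, smul_right_inj ha]

theorem eigenspace_eq_bot_of_isUnit {K V : Type*} [Field K] [AddCommGroup V] [TopologicalSpace V]
    [IsTopologicalAddGroup V] [Module K V] [ContinuousConstSMul K V] {f : V →L[K] V} {μ : K}
    (hf : IsUnit (f - μ • 1)) : Module.End.eigenspace (f : Module.End K V) μ = ⊥ := by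
  rw [Module.End.eigenspace_def]
  exact LinearMap.ker_eq_bot.2 ((Module.End.isUnit_iff _).1
    (hf.map ContinuousLinearMap.toLinearMapRingHom)).injective

section
variable {H : Type*} [NormedAddCommGroup H] [InnerProductSpace ℂ H]

theorem rootEigenspan_eq_iSup_eigenspace (S : H →L[ℂ] H) {n : ℕ} (hn : 0 < n) :
    rootEigenspan S n =
      ⨆ μ ∈ nthRootsFinset n (1 : ℂ), Module.End.eigenspace (S : Module.End ℂ H) μ := by
  refine le_antisymm (Submodule.span_le.2 ?_) (iSup₂_le fun μ hμ v hv => ?_)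
  · rintro v ⟨m, hm, hv⟩
    have hroot := (mem_nthRootsFinset hn 1).2 ((exists_lt_unityRoot_eq_iff hn).1 ⟨m, hm, rfl⟩)
    exact Submodule.mem_iSup_of_mem _ (Submodule.mem_iSup_of_mem hroot hv.1)
  · obtain ⟨m, hm, rfl⟩ := (exists_lt_unityRoot_eq_iff hn).2 ((mem_nthRootsFinset hn 1).1 hμ)
    by_cases hv0 : v = 0
    · exact hv0 ▸ zero_mem _
    · exact Submodule.subset_span ⟨m, hm, hv, hv0⟩

theorem mem_rootEigenspan_iff {S : H →L[ℂ] H} {n : ℕ} (hn : 0 < n) {v : H} :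
    v ∈ rootEigenspan S n ↔ (S ^ n) v = v := by
  rw [rootEigenspan_eq_iSup_eigenspace S hn, ← ker_aeval_prod_X_sub_C,
    ← X_pow_sub_one_eq_prod hn (Complex.isPrimitiveRoot_exp n hn.ne')]
  simp [sub_eq_zero, Module.End.pow_apply]

theorem map_mem_rootEigenspan {S : H →L[ℂ] H} {n : ℕ} (hn : 0 < n) {v : H}
    (hv : v ∈ rootEigenspan S n) : S v ∈ rootEigenspan S n := by
  rw [mem_rootEigenspan_iff hn] at hv ⊢
  rw [← mul_apply_eq_comp, pow_mul_comm', mul_apply_eq_comp, hv]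

theorem finiteDimensional_rootEigenspan (S : H →L[ℂ] H) {n : ℕ} (hn : 0 < n)
    [∀ μ : nthRootsFinset n (1 : ℂ),
      FiniteDimensional ℂ (Module.End.eigenspace (S : Module.End ℂ H) μ)] :
    FiniteDimensional ℂ (rootEigenspan S n) := by
  rw [rootEigenspan_eq_iSup_eigenspace S hn,
    iSup_subtype' (f := fun μ _ => Module.End.eigenspace (S : Module.End ℂ H) μ)]
  infer_instance

theorem finrank_rootEigenspan (S : H →L[ℂ] H) {n : ℕ} (hn : 0 < n)
    [∀ μ : nthRootsFinset n (1 : ℂ),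
      FiniteDimensional ℂ (Module.End.eigenspace (S : Module.End ℂ H) μ)] :
    finrank ℂ (rootEigenspan S n) =
      ∑ μ : nthRootsFinset n (1 : ℂ), finrank ℂ (Module.End.eigenspace (S : Module.End ℂ H) μ) := by
  rw [rootEigenspan_eq_iSup_eigenspace S hn,
    iSup_subtype' (f := fun μ _ => Module.End.eigenspace (S : Module.End ℂ H) μ)]
  exact finrank_iSup_of_iSupIndep
    ((Module.End.eigenspaces_iSupIndep (S : Module.End ℂ H)).comp Subtype.val_injective)

theorem card_nthRootsFinset_one_complex {n : ℕ} (hn : 0 < n) :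
    (nthRootsFinset n (1 : ℂ)).card = n :=
  (Complex.isPrimitiveRoot_exp n hn.ne').card_nthRootsFinset

theorem rank_rootEigenspan_le {S : H →L[ℂ] H} {n : ℕ} (hn : 0 < n)
    (hS : ∀ μ : ℂ, μ ^ n = 1 →
      Module.rank ℂ (Module.End.eigenspace (S : Module.End ℂ H) μ) ≤ 1) :
    Module.rank ℂ (rootEigenspan S n) ≤ n := by
  have hrank (μ : nthRootsFinset n (1 : ℂ)) :
      Module.rank ℂ (Module.End.eigenspace (S : Module.End ℂ H) μ) ≤ 1 :=
    hS μ ((mem_nthRootsFinset hn 1).1 μ.2)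
  have (μ : nthRootsFinset n (1 : ℂ)) :
      FiniteDimensional ℂ (Module.End.eigenspace (S : Module.End ℂ H) μ) :=
    Module.rank_lt_aleph0_iff.1 ((hrank μ).trans_lt Cardinal.one_lt_aleph0)
  have := finiteDimensional_rootEigenspan S hn
  rw [← Module.finrank_eq_rank, Nat.cast_le, finrank_rootEigenspan S hn]
  calc ∑ μ : nthRootsFinset n (1 : ℂ), finrank ℂ (Module.End.eigenspace (S : Module.End ℂ H) μ)
      ≤ ∑ _μ : nthRootsFinset n (1 : ℂ), 1 :=
        Finset.sum_le_sum fun μ _ => Module.finrank_le_of_rank_le (mod_cast hrank μ)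
    _ = n := by simp [card_nthRootsFinset_one_complex hn]

theorem finrank_rootEigenspan_eq {S : H →L[ℂ] H} {n : ℕ} (hn : 0 < n)
    (hS : ∀ μ : ℂ, μ ^ n = 1 →
      finrank ℂ (Module.End.eigenspace (S : Module.End ℂ H) μ) = 1) :
    finrank ℂ (rootEigenspan S n) = n := by
  have hfinrank (μ : nthRootsFinset n (1 : ℂ)) :
      finrank ℂ (Module.End.eigenspace (S : Module.End ℂ H) μ) = 1 :=
    hS μ ((mem_nthRootsFinset hn 1).1 μ.2)
  have (μ : nthRootsFinset n (1 : ℂ)) :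
      FiniteDimensional ℂ (Module.End.eigenspace (S : Module.End ℂ H) μ) :=
    FiniteDimensional.of_finrank_pos (by rw [hfinrank]; exact one_pos)
  simp [finrank_rootEigenspan S hn, hfinrank, card_nthRootsFinset_one_complex hn]

theorem rootEigenspan_eq_of_eigenspace_le {S T : H →L[ℂ] H} {n : ℕ} (hn : 0 < n)
    (hS : ∀ μ : ℂ, μ ^ n = 1 → finrank ℂ (Module.End.eigenspace (S : Module.End ℂ H) μ) = 1)
    (hT : ∀ μ : ℂ, μ ^ n = 1 → Module.rank ℂ (Module.End.eigenspace (T : Module.End ℂ H) μ) ≤ 1)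
    (hST : ∀ μ : ℂ, μ ^ n = 1 →
      Module.End.eigenspace (S : Module.End ℂ H) μ ≤ rootEigenspan T n) :
    rootEigenspan S n = rootEigenspan T n := by
  have hrank := rank_rootEigenspan_le hn hT
  have : FiniteDimensional ℂ (rootEigenspan T n) :=
    Module.rank_lt_aleph0_iff.1 (hrank.trans_lt Cardinal.natCast_lt_aleph0)
  refine Submodule.eq_of_le_of_finrank_le ?_ ?_
  · rw [rootEigenspan_eq_iSup_eigenspace S hn]
    exact iSup₂_le fun μ hμ => hST μ ((mem_nthRootsFinset hn 1).1 hμ)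
  · rw [finrank_rootEigenspan_eq hn hS]
    exact Module.finrank_le_of_rank_le hrank

end

/-! ### Unitary restrictions -/

open ContinuousLinearMap (adjoint)

section
variable {𝕜 E F : Type*} [RCLike 𝕜] [NormedAddCommGroup E] [InnerProductSpace 𝕜 E]
  [CompleteSpace E] [NormedAddCommGroup F] [InnerProductSpace 𝕜 F] [CompleteSpace F]

theorem norm_apply_of_adjoint_apply_apply {S : E →L[𝕜] F} {v : E} (hv : adjoint S (S v) = v) :
    ‖S v‖ = ‖v‖ := by
  have h : ‖S v‖ ^ 2 = ‖v‖ ^ 2 := by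
    rw [← inner_self_eq_norm_sq (𝕜 := 𝕜), ← ContinuousLinearMap.adjoint_inner_left, hv,
      inner_self_eq_norm_sq]
  exact (sq_eq_sq₀ (norm_nonneg _) (norm_nonneg _)).1 h

theorem adjoint_apply_apply_of_norm_eq {S : E →L[𝕜] F} (hS : ‖S‖ ≤ 1) {v : E}
    (hv : ‖S v‖ = ‖v‖) : adjoint S (S v) = v := by
  refine eq_of_norm_le_re_inner_eq_norm_sq (𝕜 := 𝕜) ?_ ?_
  · calc ‖adjoint S (S v)‖ ≤ ‖adjoint S‖ * ‖S v‖ := (adjoint S).le_opNorm _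
      _ ≤ 1 * ‖v‖ := by rw [LinearIsometryEquiv.norm_map, hv]; gcongr
      _ = ‖v‖ := one_mul _
  · rw [ContinuousLinearMap.adjoint_inner_left, inner_self_eq_norm_sq, hv]

theorem adjoint_apply_of_isStarNormal {S : E →L[𝕜] E} [IsStarNormal S] {c : 𝕜} {v : E}
    (hv : S v = c • v) : adjoint S v = star c • v := by
  have hN : IsStarNormal (S - c • 1) := by
    have hcomm : Commute (star S) S := IsStarNormal.star_comm_self
    rw [isStarNormal_iff, star_sub, star_smul, star_one]
    exact (hcomm.sub_left ((Commute.one_left S).smul_left _)).sub_right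
      ((Commute.one_right _).smul_right c)
  have h := (ContinuousLinearMap.IsStarNormal.adjoint_apply_eq_zero_iff hN v).2 (by simp [hv])
  simpa [← ContinuousLinearMap.star_eq_adjoint, sub_eq_zero] using h

end

section
variable {H : Type*} [NormedAddCommGroup H] [InnerProductSpace ℂ H] [CompleteSpace H]

theorem restrictsToUnitary_rootEigenspan {S : H →L[ℂ] H} {n : ℕ} (hn : 0 < n)
    (hS : ∀ (μ : ℂ) (v : H), ‖μ‖ = 1 → S v = μ • v → adjoint S (S v) = v) :
    RestrictsToUnitary S (rootEigenspan S n) := by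
  have hiso : rootEigenspan S n ≤ LinearMap.eqLocus (adjoint S * S : H →ₗ[ℂ] H) LinearMap.id := by
    refine Submodule.span_le.2 ?_
    rintro v ⟨m, hm, hv⟩
    have hroot := (exists_lt_unityRoot_eq_iff hn).1 ⟨m, hm, rfl⟩
    exact hS _ v (Complex.norm_eq_one_of_pow_eq_one hroot hn.ne') hv.apply_eq_smul
  let U : rootEigenspan S n →ₗᵢ[ℂ] rootEigenspan S n :=
    ⟨(S : H →ₗ[ℂ] H).restrict fun _ => map_mem_rootEigenspan hn,
      fun v => norm_apply_of_adjoint_apply_apply (hiso v.2)⟩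
  have hU : Function.Surjective U := by
    rintro ⟨v, hv⟩
    have hv' := (mem_rootEigenspan_iff hn).1 hv
    refine ⟨⟨(S ^ (n - 1)) v, (mem_rootEigenspan_iff hn).2 ?_⟩, Subtype.ext ?_⟩
    · rw [← mul_apply_eq_comp, pow_mul_comm, mul_apply_eq_comp, hv']
    · rw [← mul_pow_sub_one hn.ne'] at hv'
      exact hv'
  exact ⟨LinearIsometryEquiv.ofSurjective U hU, fun _ => rfl⟩

theorem restrictsToUnitary_rootEigenspan_of_norm_le_one {S : H →L[ℂ] H} (hS : ‖S‖ ≤ 1) {n : ℕ}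
    (hn : 0 < n) : RestrictsToUnitary S (rootEigenspan S n) :=
  restrictsToUnitary_rootEigenspan hn fun μ v hμ hv =>
    adjoint_apply_apply_of_norm_eq hS (by rw [hv, norm_smul, hμ, one_mul])

theorem restrictsToUnitary_rootEigenspan_of_isStarNormal (S : H →L[ℂ] H) [IsStarNormal S] {n : ℕ}
    (hn : 0 < n) : RestrictsToUnitary S (rootEigenspan S n) := by
  refine restrictsToUnitary_rootEigenspan hn fun μ v hμ hv => ?_
  rw [hv, map_smul, adjoint_apply_of_isStarNormal hv, smul_smul]
  simp [Complex.mul_conj, Complex.normSq_eq_norm_sq, hμ]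

end

/-! ### The Riesz projection -/

theorem resolvent_apply_of_apply_eq_smul {𝕜 E : Type*} [NontriviallyNormedField 𝕜]
    [NormedAddCommGroup E] [NormedSpace 𝕜 E] {S : E →L[𝕜] E} {w μ : 𝕜} {v : E}
    (hw : w ∈ resolventSet 𝕜 S) (hwμ : w ≠ μ) (hv : S v = μ • v) :
    resolvent S w v = (w - μ)⁻¹ • v := by
  rw [eq_inv_smul_iff₀ (sub_ne_zero_of_ne hwμ), ← map_smul]
  calc resolvent S w ((w - μ) • v) = (resolvent S w * (algebraMap 𝕜 (E →L[𝕜] E) w - S)) v := by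
        simp [Algebra.algebraMap_eq_smul_one, hv, sub_smul]
    _ = v := by rw [resolvent, Ring.inverse_mul_cancel _ hw, one_apply_eq_self]

section
variable {H : Type*} [NormedAddCommGroup H] [InnerProductSpace ℂ H]

theorem IsIsolatedSpectralPointOfMultiplicity.mem_spectrum {S : H →L[ℂ] H} {c : ℂ} {m : ℕ}
    (h : IsIsolatedSpectralPointOfMultiplicity S c m) : c ∈ spectrum ℂ S := by
  obtain ⟨r, -, hsep, -⟩ := h
  exact (hsep.ge rfl).1

theorem IsIsolatedSpectralPointOfMultiplicity.eventually_mem_resolventSet {S : H →L[ℂ] H} {c : ℂ}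
    {m : ℕ} (h : IsIsolatedSpectralPointOfMultiplicity S c m) :
    ∀ᶠ z in 𝓝[≠] c, z ∈ resolventSet ℂ S := by
  obtain ⟨r, hr, hsep, -⟩ := h
  filter_upwards [nhdsWithin_le_nhds (closedBall_mem_nhds c hr), self_mem_nhdsWithin] with z hz hzc
  by_contra hspec
  exact hzc (hsep.le ⟨hspec, hz⟩)

variable [CompleteSpace H]

theorem rieszProjection_apply_of_mem_ball {S : H →L[ℂ] H} {c μ : ℂ} {r : ℝ}
    (hS : sphere c r ⊆ resolventSet ℂ S) (hμ : μ ∈ ball c r) {v : H} (hv : S v = μ • v) :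
    rieszProjection S c r v = v := by
  have hr : 0 ≤ r := dist_nonneg.trans hμ.le
  have hint : CircleIntegrable (resolvent S) c r :=
    ContinuousOn.circleIntegrable hr fun w hw =>
      (spectrum.hasDerivAt_resolvent_const_left (hS hw)).continuousAt.continuousWithinAt
  have hcomm : (∮ w in C(c, r), resolvent S w) v = ∮ w in C(c, r), resolvent S w v := by
    simp only [circleIntegral, ContinuousLinearMap.intervalIntegral_apply hint.out,
      smul_apply]
  have hcauchy : (∮ w in C(c, r), resolvent S w v) = (2 * Real.pi * Complex.I : ℂ) • v := by
    rw [← circleIntegral.integral_sub_inv_of_mem_ball hμ, ← circleIntegral.integral_smul_const]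
    refine circleIntegral.integral_congr hr fun w hw =>
      resolvent_apply_of_apply_eq_smul (hS hw) ?_ hv
    rintro rfl
    exact (mem_ball.1 hμ).ne hw
  rw [rieszProjection, smul_apply, hcomm, hcauchy,
    inv_smul_smul₀ Complex.two_pi_I_ne_zero]

theorem IsIsolatedSpectralPointOfMultiplicity.rank_eigenspace_le {S : H →L[ℂ] H} {c : ℂ} {m : ℕ}
    (h : IsIsolatedSpectralPointOfMultiplicity S c m) :
    Module.rank ℂ (Module.End.eigenspace (S : Module.End ℂ H) c) ≤ m := by
  obtain ⟨r, hr, hsep, hrank⟩ := h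
  have hsphere : sphere c r ⊆ resolventSet ℂ S := by
    intro w hw
    by_contra hspec
    have hwc : w ∈ ({c} : Set ℂ) := hsep ▸ ⟨hspec, sphere_subset_closedBall hw⟩
    exact ne_of_mem_sphere hw hr.ne' hwc
  rw [← hrank]
  exact Submodule.rank_mono fun v hv => ⟨v, rieszProjection_apply_of_mem_ball hsphere
    (mem_ball_self hr) (Module.End.mem_eigenspace_iff.1 hv)⟩

end

/-! ### Isolated spectral points of normal operators -/

theorem continuousOn_piSingle_of_eventually_notMem {X Y : Type*} [TopologicalSpace X] [T1Space X]
    [DecidableEq X] [TopologicalSpace Y] [Zero Y] {s : Set X} {c : X}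
    (hc : ∀ᶠ z in 𝓝[≠] c, z ∉ s) (y : Y) : ContinuousOn (Pi.single c y : X → Y) s := by
  intro z _
  rcases eq_or_ne z c with rfl | hzc
  · refine continuousWithinAt_const.congr_of_eventuallyEq ?_ rfl
    rw [eventually_nhdsWithin_iff] at hc
    filter_upwards [self_mem_nhdsWithin, nhdsWithin_le_nhds hc] with w hw hwc
    exact congrArg _ (not_not.1 fun hwz => hwc hwz hw)
  · refine (continuousWithinAt_const (b := 0)).congr_of_eventuallyEq ?_
      (Pi.single_eq_of_ne (M := fun _ => Y) hzc y)
    filter_upwards [nhdsWithin_le_nhds (isOpen_ne.mem_nhds hzc)] with w hw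
    exact Pi.single_eq_of_ne (M := fun _ => Y) hw y

theorem exists_isStarProjection_of_isolated {𝓐 : Type*} [CStarAlgebra 𝓐] {a : 𝓐} [IsStarNormal a]
    {c : ℂ} (hc : ∀ᶠ z in 𝓝[≠] c, z ∈ resolventSet ℂ a) :
    ∃ p : 𝓐, IsStarProjection p ∧ a * p = c • p ∧ IsUnit (a - c • 1 + p) := by
  set f : ℂ → ℂ := Pi.single c 1
  have hf : ContinuousOn f (spectrum ℂ a) :=
    continuousOn_piSingle_of_eventually_notMem (hc.mono fun _ => Set.notMem_compl_iff.2) 1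
  have hf_values (z : ℂ) : f z = 0 ∨ z = c ∧ f z = 1 := by
    rcases eq_or_ne z c with rfl | hzc
    · exact .inr ⟨rfl, by simp [f]⟩
    · exact .inl (by simp [f, hzc])
  refine ⟨cfc f a, ⟨?_, ?_⟩, ?_, ?_⟩
  · rw [IsIdempotentElem, ← cfc_mul f f a]
    exact cfc_congr fun z _ => by rcases hf_values z with h | ⟨-, h⟩ <;> simp [h]
  · rw [IsSelfAdjoint, ← cfc_star]
    exact cfc_congr fun z _ => by rcases hf_values z with h | ⟨-, h⟩ <;> simp [h]
  · nth_rw 1 [← cfc_id' ℂ a]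
    rw [← cfc_mul (fun z => z) f a, ← cfc_const_mul c f a]
    exact cfc_congr fun z _ => by rcases hf_values z with h | ⟨rfl, h⟩ <;> simp [h]
  · have hsum : a - c • 1 + cfc f a = cfc (fun z => z - c + f z) a := by
      rw [cfc_add (a := a) (fun z => z - c) f, cfc_sub (fun z => z) (fun _ => c) a, cfc_id' ℂ a,
        cfc_const c a, Algebra.algebraMap_eq_smul_one]
    rw [hsum, isUnit_cfc_iff _ a]
    intro z _
    rcases eq_or_ne z c with rfl | hzc
    · simp [f]
    · simp [f, hzc, sub_ne_zero]

theorem exists_norm_eq_one_and_eq_span_singleton {𝕜 E : Type*} [RCLike 𝕜] [NormedAddCommGroup E]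
    [NormedSpace 𝕜 E] {p : Submodule 𝕜 E} (hrank : Module.rank 𝕜 p ≤ 1) (hp : p ≠ ⊥) :
    ∃ e : E, ‖e‖ = 1 ∧ p = 𝕜 ∙ e := by
  obtain ⟨v, hv, hpv⟩ := (rank_submodule_le_one_iff p).1 hrank
  have hv0 : v ≠ 0 := by
    rintro rfl
    exact hp (by simpa using hpv)
  have hc : (‖v‖ : 𝕜)⁻¹ ≠ 0 := by simpa
  refine ⟨(‖v‖ : 𝕜)⁻¹ • v, norm_smul_inv_norm hv0, ?_⟩
  rw [Submodule.span_singleton_smul_eq hc.isUnit]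
  exact le_antisymm hpv ((Submodule.span_singleton_le_iff_mem v p).2 hv)

theorem range_eq_eigenspace_of_injective {R M : Type*} [CommRing R] [AddCommGroup M] [Module R M]
    {f p : Module.End R M} {c : R} (hp : IsIdempotentElem p) (hfp : f * p = c • p)
    (hinj : Function.Injective ⇑(f - c • 1 + p)) : p.range = f.eigenspace c := by
  have hfpv (v : M) : f (p v) = c • p v := DFunLike.congr_fun hfp v
  have hppv (v : M) : p (p v) = p v := DFunLike.congr_fun hp.eq v
  refine le_antisymm ?_ fun v hv => ⟨v, hinj ?_⟩
  · rintro _ ⟨v, rfl⟩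
    exact Module.End.mem_eigenspace_iff.2 (hfpv v)
  · simp [Module.End.mem_eigenspace_iff.1 hv, hfpv, hppv]

theorem exists_isUnit_add_innerSL_smulRight {H : Type*} [NormedAddCommGroup H]
    [InnerProductSpace ℂ H] [CompleteSpace H] {S : H →L[ℂ] H} [IsStarNormal S] {c : ℂ}
    (h : IsIsolatedSpectralPointOfMultiplicity S c 1) :
    ∃ e : H, ‖e‖ = 1 ∧ Module.End.eigenspace (S : Module.End ℂ H) c = ℂ ∙ e ∧
      IsUnit (S - c • 1 + (innerSL ℂ e).smulRight e) := by
  obtain ⟨P, hP, hSP, hU⟩ := exists_isStarProjection_of_isolated h.eventually_mem_resolventSet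
  have hrange : P.range = Module.End.eigenspace (S : Module.End ℂ H) c :=
    range_eq_eigenspace_of_injective
      (hP.isIdempotentElem.map ContinuousLinearMap.toLinearMapRingHom)
      (congrArg ContinuousLinearMap.toLinearMap hSP)
      (ContinuousLinearMap.isUnit_iff_bijective.1 hU).injective
  have hne : Module.End.eigenspace (S : Module.End ℂ H) c ≠ ⊥ := by
    intro hbot
    have hP0 : P = 0 := ContinuousLinearMap.coe_injective
      (LinearMap.range_eq_bot.1 (hrange.trans hbot))
    refine h.mem_spectrum ?_
    rw [← Algebra.algebraMap_eq_smul_one, hP0, add_zero] at hU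
    rw [← IsUnit.neg_iff, neg_sub] at hU
    exact hU
  obtain ⟨e, he, hspan⟩ :=
    exists_norm_eq_one_and_eq_span_singleton (mod_cast h.rank_eigenspace_le) hne
  obtain ⟨_, hPstar⟩ := isStarProjection_iff_eq_starProjection_range.1 hP
  have hPe : P = (innerSL ℂ e).smulRight e := by
    ext x
    calc P x = P.range.starProjection x := DFunLike.congr_fun hPstar x
      _ = (ℂ ∙ e).starProjection x := by simp only [hrange, hspan]
      _ = inner ℂ e x • e := Submodule.starProjection_unit_singleton ℂ he x
  exact ⟨e, he, hspan, hPe ▸ hU⟩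

/-! ### Families of singular operators with a simple kernel -/

theorem isUnit_one_sub_of_mul_self_eq_smul {K R : Type*} [Field K] [Ring R] [Algebra K R] {r : R}
    {μ : K} (hr : r * r = μ • r) (hμ : μ ≠ 1) : IsUnit (1 - r) := by
  have hμ' : 1 - μ ≠ 0 := sub_ne_zero.2 hμ.symm
  refine isUnit_iff_exists.2 ⟨1 + (1 - μ)⁻¹ • r, ?_, ?_⟩
  all_goals
    simp only [mul_add, add_mul, sub_mul, mul_sub, mul_smul_comm, smul_mul_assoc, hr, mul_one,
      one_mul]
    match_scalars <;> field_simp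
    ring

theorem hasDerivAt_ringInverse_comp {𝕜 R : Type*} [NontriviallyNormedField 𝕜] [NormedRing R]
    [HasSummableGeomSeries R] [NormedAlgebra 𝕜 R] {g : 𝕜 → R} {g' : R} {a : 𝕜}
    (hg : HasDerivAt g g' a) (hu : IsUnit (g a)) :
    HasDerivAt (fun t => Ring.inverse (g t))
      (-(Ring.inverse (g a) * g' * Ring.inverse (g a))) a := by
  obtain ⟨x, hx⟩ := hu
  have h := hasFDerivAt_ringInverse (𝕜 := 𝕜) x
  rw [← Ring.inverse_unit, hx] at h
  exact h.comp_hasDerivAt a hg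

section
variable {𝕜 E : Type*} [NontriviallyNormedField 𝕜] [NormedAddCommGroup E] [NormedSpace 𝕜 E]

theorem apply_inverse_eq_one_of_not_isUnit_sub {G : E →L[𝕜] E} {ψ : E →L[𝕜] 𝕜} {y : E}
    (hG : IsUnit G) (h : ¬ IsUnit (G - ψ.smulRight y)) : ψ (Ring.inverse G y) = 1 := by
  by_contra hne
  have hGy : G (Ring.inverse G y) = y := DFunLike.congr_fun (Ring.mul_inverse_cancel G hG) y
  have hfactor : G * (1 - ψ.smulRight (Ring.inverse G y)) = G - ψ.smulRight y := by
    ext v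
    simp [hGy]
  refine h (hfactor ▸ hG.mul
    (isUnit_one_sub_of_mul_self_eq_smul (μ := ψ (Ring.inverse G y)) ?_ hne))
  ext v
  simp [smul_smul, mul_comm]

theorem apply_deriv_apply_eq_zero_of_eventually_not_isUnit [CompleteSpace E] {K : 𝕜 → E →L[𝕜] E}
    {K' : E →L[𝕜] E} {a : 𝕜} {e y : E} {φ ψ : E →L[𝕜] 𝕜} (hK : HasDerivAt K K' a)
    (he : K a e = 0) (hφ : ∀ v, φ (K a v) = 0) (hψ : ψ e = 1)
    (hG : IsUnit (K a + ψ.smulRight y)) (hsing : ∀ᶠ t in 𝓝 a, ¬ IsUnit (K t)) :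
    φ (K' e) = 0 := by
  set G : 𝕜 → E →L[𝕜] E := fun t => K t + ψ.smulRight y
  have hGderiv : HasDerivAt G K' a := hK.add_const _
  have hGe : G a e = y := by simp [G, he, hψ]
  have hinv_y : Ring.inverse (G a) y = e := by
    rw [← hGe]
    exact DFunLike.congr_fun (Ring.inverse_mul_cancel _ hG) e
  -- Since `K t = G t - ψ(·) y` is singular, `t ↦ ψ ((G t)⁻¹ y)` is constant near `a`.
  have hsecular : ∀ᶠ t in 𝓝 a, ψ (Ring.inverse (G t) y) = 1 := by
    filter_upwards [hsing, hGderiv.continuousAt.eventually (Units.isOpen.mem_nhds hG)] with t ht hGt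
    exact apply_inverse_eq_one_of_not_isUnit_sub hGt (by simpa [G] using ht)
  have hsecular_deriv :
      HasDerivAt (fun t => ψ (Ring.inverse (G t) y)) (-ψ (Ring.inverse (G a) (K' e))) a := by
    simpa [hinv_y, Function.comp_def] using ψ.hasFDerivAt.comp_hasDerivAt a
      ((hasDerivAt_ringInverse_comp hGderiv hG).clm_apply (hasDerivAt_const a y))
  have hψ_zero : ψ (Ring.inverse (G a) (K' e)) = 0 :=
    neg_eq_zero.1 (hsecular_deriv.unique
      ((hasDerivAt_const a (1 : 𝕜)).congr_of_eventuallyEq hsecular))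
  calc φ (K' e) = φ (G a (Ring.inverse (G a) (K' e))) := by
        rw [← mul_apply_eq_comp, Ring.mul_inverse_cancel _ hG, one_apply_eq_self]
    _ = ψ (Ring.inverse (G a) (K' e)) * φ y := by simp [G, hφ]
    _ = 0 := by rw [hψ_zero, zero_mul]

end

/-! ### Comparison of power series -/

theorem eq_of_eventually_hasSum_pow_smul {𝕜 E : Type*} [NontriviallyNormedField 𝕜]
    [NormedAddCommGroup E] [NormedSpace 𝕜 E] {f : 𝕜 → E} {a b : ℕ → E}
    (ha : ∀ᶠ u in 𝓝 (0 : 𝕜), HasSum (fun k => u ^ k • a k) (f u))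
    (hb : ∀ᶠ u in 𝓝 (0 : 𝕜), HasSum (fun k => u ^ k • b k) (f u)) : a = b := by
  have hseries (c : ℕ → E) (hc : ∀ᶠ u in 𝓝 (0 : 𝕜), HasSum (fun k => u ^ k • c k) (f u)) :
      HasFPowerSeriesAt f (fun k => ContinuousMultilinearMap.mkPiRing 𝕜 (Fin k) (c k)) 0 := by
    refine hasFPowerSeriesAt_iff.2 ?_
    simpa [FormalMultilinearSeries.coeff] using hc
  have h := (hseries a ha).eq_formalMultilinearSeries (hseries b hb)
  funext k
  simpa using DFunLike.congr_fun (congrFun h k) 1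

theorem eventually_hasSum_pow_smul_pow {𝕜 R : Type*} [NontriviallyNormedField 𝕜] [NormedRing R]
    [NormedAlgebra 𝕜 R] [HasSummableGeomSeries R] (b : R) :
    ∀ᶠ u in 𝓝 (0 : 𝕜), HasSum (fun k => u ^ k • b ^ k) (Ring.inverse (1 - u • b)) := by
  have hcont : ContinuousAt (fun u : 𝕜 => ‖u • b‖) 0 := by fun_prop
  filter_upwards [hcont.eventually_lt_const (u := 1) (by simp)] with u hu
  simpa [_root_.smul_pow] using hasSum_geom_series_inverse (u • b) hu

theorem apply_pow_add_eq_of_eventually_eq {𝕜 R : Type*} [NontriviallyNormedField 𝕜] [NormedRing R]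
    [NormedAlgebra 𝕜 R] [HasSummableGeomSeries R] {b : R} {ℓ₁ ℓ₂ : R →L[𝕜] 𝕜} {m : ℕ}
    (h : ∀ᶠ u in 𝓝 (0 : 𝕜),
      ℓ₁ (Ring.inverse (1 - u • b)) = u ^ m * ℓ₂ (Ring.inverse (1 - u • b))) (k : ℕ) :
    ℓ₁ (b ^ (k + m)) = ℓ₂ (b ^ k) := by
  have hgeom := eventually_hasSum_pow_smul_pow (𝕜 := 𝕜) b
  set c : ℕ → 𝕜 := fun j => if j < m then 0 else ℓ₂ (b ^ (j - m))
  have hleft : ∀ᶠ u in 𝓝 (0 : 𝕜),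
      HasSum (fun j => u ^ j • ℓ₁ (b ^ j)) (ℓ₁ (Ring.inverse (1 - u • b))) := by
    filter_upwards [hgeom] with u hu
    simpa using ℓ₁.hasSum hu
  have hright : ∀ᶠ u in 𝓝 (0 : 𝕜),
      HasSum (fun j => u ^ j • c j) (ℓ₁ (Ring.inverse (1 - u • b))) := by
    filter_upwards [hgeom, h] with u hu hℓ
    have hzero : ∑ j ∈ Finset.range m, u ^ j • c j = 0 :=
      Finset.sum_eq_zero fun j hj => by simp [c, Finset.mem_range.1 hj]
    rw [hℓ, ← hasSum_nat_add_iff' m, hzero, sub_zero]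
    simpa [c, pow_add, mul_assoc, mul_left_comm] using (ℓ₂.hasSum hu).mul_left (u ^ m)
  simpa [c] using congrFun (eq_of_eventually_hasSum_pow_smul hleft hright) (k + m)

/-! ### The Fourier surface -/

theorem exists_hasDerivAt_pow_eq {f : ℂ → ℂ} {f' a c : ℂ} {n : ℕ} (hn : n ≠ 0)
    (hf : HasDerivAt f f' a) (hfa : f a = c ^ n) (hc : c ≠ 0) :
    ∃ g : ℂ → ℂ, g a = c ∧ HasDerivAt g (f' / (n * c ^ (n - 1))) a ∧ ∀ t, g t ^ n = f t := by
  have hquot : f a / c ^ n = 1 := by rw [hfa, div_self (pow_ne_zero n hc)]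
  have hroot := (hf.div_const (c ^ n)).cpow_const (c := (n : ℂ)⁻¹)
    (hquot ▸ Complex.one_mem_slitPlane)
  refine ⟨fun t => c * (f t / c ^ n) ^ (n : ℂ)⁻¹, by simp [hquot], ?_, fun t => ?_⟩
  · refine (hroot.const_mul c).congr_deriv ?_
    rw [hquot, Complex.one_cpow, ← mul_pow_sub_one hn c]
    field_simp
  · rw [mul_pow, Complex.cpow_nat_inv_pow _ hn, mul_div_cancel₀ _ (pow_ne_zero n hc)]

theorem exists_hasDerivAt_mem_fourierSurface {n : ℕ} (hn : 0 < n) {c : ℂ} (hc : c ^ n = 1)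
    (u : ℂ) :
    ∃ x : ℂ → ℂ, x 0 = c ∧ HasDerivAt x (-(u ^ (n - 1) * c)) 0 ∧
      ∀ t, ![x t, u + t, -(c * u)] ∈ fourierSurface n := by
  have hc0 : c ≠ 0 := by
    rintro rfl
    simp [hn.ne'] at hc
  have hf : HasDerivAt (fun t : ℂ => 1 + u ^ n - (u + t) ^ n) (-(n * u ^ (n - 1))) 0 := by
    simpa using (((hasDerivAt_id (0 : ℂ)).const_add u).pow n).const_sub (1 + u ^ n)
  obtain ⟨x, hx0, hx', hxpow⟩ := exists_hasDerivAt_pow_eq hn.ne' hf (by simp [hc]) hc0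
  refine ⟨x, hx0, ?_, fun t => ?_⟩
  · refine hx'.congr_deriv ?_
    have hn' : (n : ℂ) ≠ 0 := Nat.cast_ne_zero.2 hn.ne'
    rw [← mul_pow_sub_one hn.ne'] at hc
    field_simp
    linear_combination u ^ (n - 1) * hc
  · have hsign : (-1 : ℂ) ^ (n - 1) * (-(c * u)) ^ n = -u ^ n := by
      rw [neg_pow (c * u), mul_pow, hc, ← mul_assoc, ← pow_add, Odd.neg_one_pow ⟨n - 1, by omega⟩]
      ring
    simp [fourierSurface, hxpow, hsign]

theorem isOpen_polydisk {k : ℕ} (c : Fin k → ℂ) (r : ℝ) : IsOpen (polydisk c r) := by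
  simp only [polydisk, Set.ofPred_forall]
  exact isOpen_iInter_of_finite fun j => isOpen_lt (by fun_prop) continuous_const

theorem mem_polydisk_self {k : ℕ} (c : Fin k → ℂ) {r : ℝ} (hr : 0 < r) : c ∈ polydisk c r :=
  fun j => by simpa using hr

theorem exists_hasDerivAt_eventually_mem_fourierSurface_inter_polydisk {n : ℕ} (hn : 0 < n) {c : ℂ}
    (hc : c ^ n = 1) {u : ℂ} {ε : ℝ} (hu : ‖u‖ < ε) :
    ∃ x : ℂ → ℂ, x 0 = c ∧ HasDerivAt x (-(u ^ (n - 1) * c)) 0 ∧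
      ∀ᶠ t in 𝓝 0, ![x t, u + t, -(c * u)] ∈ fourierSurface n ∩ polydisk ![c, 0, 0] ε := by
  obtain ⟨x, hx0, hx', hxmem⟩ := exists_hasDerivAt_mem_fourierSurface hn hc u
  have hcont : ContinuousAt (fun t => ![x t, u + t, -(c * u)]) 0 := by
    have := hx'.continuousAt
    fun_prop
  have hmem : ![x 0, u + 0, -(c * u)] ∈ polydisk ![c, 0, 0] ε := by
    have hε : 0 < ε := (norm_nonneg u).trans_lt hu
    have hcnorm : ‖c‖ = 1 := Complex.norm_eq_one_of_pow_eq_one hc hn.ne'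
    simp [polydisk, Fin.forall_fin_succ, hx0, hcnorm, hu, hε]
  refine ⟨x, hx0, hx', ?_⟩
  filter_upwards [hcont.eventually ((isOpen_polydisk _ ε).mem_nhds hmem)] with t ht
  exact ⟨hxmem t, ht⟩

theorem axis_mem_fourierSurface {n : ℕ} (hn : 0 < n) {c : ℂ} (hc : c ^ n = 1) :
    ![c, 0, 0] ∈ fourierSurface n := by
  simp [fourierSurface, hc, hn.ne']

section
variable {H : Type*} [NormedAddCommGroup H] [InnerProductSpace ℂ H]

theorem pencil_three (T₁ T₂ T₃ : H →L[ℂ] H) (x y z : ℂ) :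
    pencil ![T₁, T₂, T₃] ![x, y, z] = x • T₁ + y • T₂ + z • T₃ := by
  simp [pencil, Fin.sum_univ_three]

theorem pencil_sub_one_eq_mul (A B : H →L[ℂ] H) (c u : ℂ) :
    pencil ![A, B, A * B] ![c, u, -(c * u)] - 1 = (c • A - 1) * (1 - u • B) := by
  rw [pencil_three]
  simp only [mul_sub, sub_mul, mul_one, one_mul, smul_mul_smul_comm, neg_smul]
  abel

variable [CompleteSpace H]

theorem inner_apply_inverse_eq_of_fourierSurface_subset {A B : H →L[ℂ] H} [IsStarNormal A] {n : ℕ}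
    (hn : 0 < n) {c : ℂ} (hc : c ^ n = 1) {ε : ℝ}
    (hsub : fourierSurface n ∩ polydisk ![c, 0, 0] ε ⊆ properJointSpectrum ![A, B, A * B])
    {e : H} (he : ‖e‖ = 1) (hAe : (c • A) e = e)
    (hG : IsUnit (c • A - 1 + (innerSL ℂ e).smulRight e)) {u : ℂ} (hu : ‖u‖ < ε)
    (huB : IsUnit (1 - u • B)) :
    inner ℂ e (B (Ring.inverse (1 - u • B) e)) =
      u ^ (n - 1) * inner ℂ e (Ring.inverse (1 - u • B) e) := by
  obtain ⟨x, hx0, hx', hxmem⟩ :=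
    exists_hasDerivAt_eventually_mem_fourierSurface_inter_polydisk hn hc hu
  set V : H →L[ℂ] H := Ring.inverse (1 - u • B) with hV
  set K : ℂ → H →L[ℂ] H := fun t => pencil ![A, B, A * B] ![x t, u + t, -(c * u)] - 1 with hK
  have hKV : K 0 * V = c • A - 1 := by
    rw [hK, hV]
    simp only [hx0, add_zero]
    rw [pencil_sub_one_eq_mul, Ring.mul_inverse_cancel_right _ _ huB]
  have hK' : HasDerivAt K (-(u ^ (n - 1)) • (c • A) + B) 0 := by
    simp only [hK, pencil_three]
    simpa [mul_smul] using (((hx'.smul_const A).add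
      (((hasDerivAt_id (0 : ℂ)).const_add u).smul_const B)).add_const
        (-(c * u) • (A * B))).sub_const 1
  have hinner (v : H) : inner ℂ e ((c • A) v) = inner ℂ e v := by
    have hadj := adjoint_apply_of_isStarNormal (S := c • A) (c := 1) (by simpa using hAe)
    rw [← ContinuousLinearMap.adjoint_inner_left, hadj, star_one, one_smul]
  have hsing : ∀ᶠ t in 𝓝 0, ¬ IsUnit (K t * V) := by
    filter_upwards [hxmem] with t ht
    rw [huB.ringInverse.mul_right_iff]
    exact hsub ht
  have hzero := apply_deriv_apply_eq_zero_of_eventually_not_isUnit (φ := innerSL ℂ e)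
    (ψ := innerSL ℂ e) (e := e) (y := e) (hK'.mul_const V)
    (by rw [hKV, sub_apply, hAe, one_apply_eq_self, sub_self])
    (fun v => by
      rw [hKV, innerSL_apply_apply, sub_apply, inner_sub_right, hinner, one_apply_eq_self,
        sub_self])
    (by simp [he]) (hKV ▸ hG) hsing
  rw [innerSL_apply_apply, mul_apply_eq_comp, add_apply, inner_add_right, smul_apply,
    inner_smul_right, hinner] at hzero
  linear_combination hzero

theorem pow_apply_eq_self_of_fourierSurface_subset {A B : H →L[ℂ] H} [IsStarNormal A]
    (hB : ‖B‖ ≤ 1) {n : ℕ} (hn : 0 < n) {c : ℂ} (hc : c ^ n = 1) {ε : ℝ} (hε : 0 < ε)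
    (hsub : fourierSurface n ∩ polydisk ![c, 0, 0] ε ⊆ properJointSpectrum ![A, B, A * B])
    {e : H} (he : ‖e‖ = 1) (hAe : (c • A) e = e)
    (hG : IsUnit (c • A - 1 + (innerSL ℂ e).smulRight e)) :
    (B ^ n) e = e := by
  have hunit : ∀ᶠ u in 𝓝 (0 : ℂ), IsUnit (1 - u • B) := by
    have hcont : ContinuousAt (fun u : ℂ => 1 - u • B) 0 := by fun_prop
    exact hcont.eventually (Units.isOpen.mem_nhds (by simp))
  have hinner : inner ℂ e ((B ^ n) e) = 1 := by
    have h := apply_pow_add_eq_of_eventually_eq (b := B) (m := n - 1)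
      (ℓ₁ := innerSL ℂ e ∘L B ∘L ContinuousLinearMap.apply ℂ H e)
      (ℓ₂ := innerSL ℂ e ∘L ContinuousLinearMap.apply ℂ H e) ?_ 0
    · rw [← mul_pow_sub_one hn.ne', mul_apply_eq_comp]
      simpa [he] using h
    · filter_upwards [hunit, ball_mem_nhds 0 hε] with u hu huε
      exact inner_apply_inverse_eq_of_fourierSurface_subset hn hc hsub he hAe hG
        (by simpa using huε) hu
  refine eq_of_norm_le_re_inner_eq_norm_sq (𝕜 := ℂ) ?_ ?_
  · calc ‖(B ^ n) e‖ ≤ ‖B ^ n‖ * ‖e‖ := (B ^ n).le_opNorm e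
      _ ≤ ‖B‖ ^ n * ‖e‖ := by gcongr; exact norm_pow_le' B hn
      _ ≤ ‖e‖ := mul_le_of_le_one_left (norm_nonneg e) (pow_le_one₀ (norm_nonneg B) hB)
  · rw [← inner_conj_symm, hinner, he]
    simp
end

section
variable {H : Type*} [NormedAddCommGroup H] [InnerProductSpace ℂ H] [CompleteSpace H]

theorem finrank_eigenspace_eq_one_and_eigenspace_le_rootEigenspan {A B : H →L[ℂ] H} [IsStarNormal A]
    (hB : ‖B‖ ≤ 1) {n : ℕ} (hn : 0 < n) {c : ℂ} (hc : c ^ n = 1) {ε : ℝ} (hε : 0 < ε)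
    (hsub : fourierSurface n ∩ polydisk ![c, 0, 0] ε ⊆ properJointSpectrum ![A, B, A * B])
    (hmult : ![c, 0, 0] ∈ properJointSpectrum ![A, B, A * B] →
      HasMultiplicityAt ![A, B, A * B] ![c, 0, 0] 1) :
    finrank ℂ (Module.End.eigenspace (A : Module.End ℂ H) c⁻¹) = 1 ∧
      Module.End.eigenspace (A : Module.End ℂ H) c⁻¹ ≤ rootEigenspan B n := by
  have hc0 : c ≠ 0 := (IsUnit.of_pow_eq_one hc hn.ne').ne_zero
  have h := hmult (hsub ⟨axis_mem_fourierSurface hn hc, mem_polydisk_self _ hε⟩)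
  simp only [HasMultiplicityAt, pencil_three, zero_smul, add_zero] at h
  obtain ⟨e, he, hspan, hG⟩ := exists_isUnit_add_innerSL_smulRight h
  have hspanA : Module.End.eigenspace (A : Module.End ℂ H) c⁻¹ = ℂ ∙ e := by
    rw [← hspan, ← eigenspace_smul_mul _ hc0, mul_inv_cancel₀ hc0]
    rfl
  have hAe : (c • A) e = e := by
    have hmem := hspan.ge (Submodule.mem_span_singleton_self e)
    simpa using Module.End.mem_eigenspace_iff.1 hmem
  rw [one_smul] at hG
  rw [hspanA, Submodule.span_singleton_le_iff_mem, mem_rootEigenspan_iff hn]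
  exact ⟨finrank_span_singleton (by simp [← norm_pos_iff, he]),
    pow_apply_eq_self_of_fourierSurface_subset hB hn hc hε hsub he hAe hG⟩

theorem rank_eigenspace_le_one_of_hasMultiplicityAt {A B C : H →L[ℂ] H} {c : ℂ} (hc : c ≠ 0)
    (hmult : ![0, c, 0] ∈ properJointSpectrum ![A, B, C] →
      HasMultiplicityAt ![A, B, C] ![0, c, 0] 1) :
    Module.rank ℂ (Module.End.eigenspace (B : Module.End ℂ H) c⁻¹) ≤ 1 := by
  rw [← eigenspace_smul_mul _ hc, mul_inv_cancel₀ hc, ← ContinuousLinearMap.toLinearMap_smul]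
  simp only [properJointSpectrum, HasMultiplicityAt, Set.mem_ofPred_eq, pencil_three, zero_smul,
    add_zero, zero_add] at hmult
  by_cases hunit : IsUnit (c • B - 1)
  · rw [eigenspace_eq_bot_of_isUnit (by rwa [one_smul]), rank_bot]
    exact zero_le_one
  · exact_mod_cast (hmult hunit).rank_eigenspace_le

end

theorem mainTheorem1_general {H : Type*} [NormedAddCommGroup H] [InnerProductSpace ℂ H]
    [CompleteSpace H] (A B : H →L[ℂ] H) [IsStarNormal A] (hB : ‖B‖ ≤ 1)
    (n : ℕ) (hn : 0 < n) (ε : ℝ) (hε : 0 < ε)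
    (hsub : ∀ j < n, fourierSurface n ∩ polydisk ![unityRoot n j, 0, 0] ε ⊆
      properJointSpectrum ![A, B, A * B])
    (hmult : ∀ j < n, ∀ τ : Fin 3 → ℂ,
      (τ = ![unityRoot n j, 0, 0] ∨ τ = ![0, unityRoot n j, 0]) →
        τ ∈ properJointSpectrum ![A, B, A * B] → HasMultiplicityAt ![A, B, A * B] τ 1) :
    finrank ℂ (rootEigenspan A n) = n ∧
      (∀ v ∈ rootEigenspan A n, B v ∈ rootEigenspan A n) ∧
      RestrictsToUnitary B (rootEigenspan A n) ∧
      RestrictsToUnitary A (rootEigenspan A n) := by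
  have hroot {μ : ℂ} (hμ : μ ^ n = 1) : ∃ j < n, (unityRoot n j)⁻¹ = μ := by
    simpa only [inv_eq_iff_eq_inv] using
      (exists_lt_unityRoot_eq_iff hn (μ := μ⁻¹)).2 (by rw [inv_pow, hμ, inv_one])
  have hA_eigen (μ : ℂ) (hμ : μ ^ n = 1) :
      finrank ℂ (Module.End.eigenspace (A : Module.End ℂ H) μ) = 1 ∧
        Module.End.eigenspace (A : Module.End ℂ H) μ ≤ rootEigenspan B n := by
    obtain ⟨j, hj, rfl⟩ := hroot hμ
    exact finrank_eigenspace_eq_one_and_eigenspace_le_rootEigenspan hB hn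
      ((exists_lt_unityRoot_eq_iff hn).1 ⟨j, hj, rfl⟩) hε (hsub j hj) (hmult j hj _ (.inl rfl))
  have hB_eigen (μ : ℂ) (hμ : μ ^ n = 1) :
      Module.rank ℂ (Module.End.eigenspace (B : Module.End ℂ H) μ) ≤ 1 := by
    obtain ⟨j, hj, rfl⟩ := hroot hμ
    exact rank_eigenspace_le_one_of_hasMultiplicityAt (Complex.exp_ne_zero _)
      (hmult j hj _ (.inr rfl))
  have heq : rootEigenspan A n = rootEigenspan B n :=
    rootEigenspan_eq_of_eigenspace_le hn (fun μ hμ => (hA_eigen μ hμ).1) hB_eigen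
      fun μ hμ => (hA_eigen μ hμ).2
  refine ⟨finrank_rootEigenspan_eq hn fun μ hμ => (hA_eigen μ hμ).1, ?_, ?_,
    restrictsToUnitary_rootEigenspan_of_isStarNormal A hn⟩
  · exact heq ▸ fun v hv => map_mem_rootEigenspan hn hv
  · exact heq ▸ restrictsToUnitary_rootEigenspan_of_norm_le_one hB hn

theorem mainTheorem1 {H : Type*} [NormedAddCommGroup H] [InnerProductSpace ℂ H]
    [CompleteSpace H] (A B : H →L[ℂ] H) (hA : IsStarNormal A) (hB : ‖B‖ = 1)
    (n : ℕ) (hn : 0 < n) (ε : ℝ) (hε : 0 < ε)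
    (hspec : ∀ j < n, ∀ τ : Fin 3 → ℂ,
      (τ = ![unityRoot n j, 0, 0] ∨ τ = ![0, unityRoot n j, 0]) →
        properJointSpectrum ![A, B, A * B] ∩ polydisk τ ε = fourierSurface n ∩ polydisk τ ε)
    (hmult : ∀ j < n, ∀ τ : Fin 3 → ℂ,
      (τ = ![unityRoot n j, 0, 0] ∨ τ = ![0, unityRoot n j, 0]) →
        ∀ x ∈ properJointSpectrum ![A, B, A * B] ∩ polydisk τ ε,
          HasMultiplicityAt ![A, B, A * B] x 1) :
    Module.finrank ℂ (rootEigenspan A n) = n ∧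
      (∀ v ∈ rootEigenspan A n, B v ∈ rootEigenspan A n) ∧
      RestrictsToUnitary B (rootEigenspan A n) ∧
      RestrictsToUnitary A (rootEigenspan A n) :=
  mainTheorem1_general A B hB.le n hn ε hε
    (fun j hj => (hspec j hj _ (.inl rfl)).ge.trans Set.inter_subset_left)
    fun j hj τ hτ hmem => hmult j hj τ hτ τ ⟨hmem, mem_polydisk_self τ hε⟩
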